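/- Let $T$ be any first-order theory in a language $L$, and let $\mathfrak C$ be a monster model of $T$, that is, a $\kappa$-saturated model for some cardinal $\kappa>|L|+\aleph_0$; a set is called small if it has fewer than $\kappa$ elements. A formula $\varphi(x,b)$ divides over a set $A$ if for some $k<\omega$ there is a sequence $(b_i)_{i<\omega}$ of realizations of $\mathrm{tp}(b/A)$ such that any $k$ of the formulas $\varphi(x,b_i)$ (for distinct indices $i$) are jointly inconsistent. It forks over $A$ if it implies a finite disjunction of formulas (with parameters in $\mathfrak C$), each of which divides over $A$. For a tuple $a$, possibly infinite, and sets $B,C$, write $a\perp_C B$ (non-forking) if no formula in $\mathrm{tp}(a/BC)$ forks over $C$; a tuple written in place of a set stands for the set of its entries, and a set on the left stands for an enumeration of it. Let $\mathrm{acl}$ denote algebraic closure in $\mathfrak C$. Let $A\subseteq\mathfrak C$ be small, and suppose that forking equals dividing over $A$: a formula forks over $A$ if and only if it divides over $A$. Then: 1. $A$ is an extension base for non-forking: $a\perp_A A$ for every tuple $a$. 2. Non-forking has left extension over $A$: if $d$ is a small tuple, $a$ is a tuple all of whose entries are entries of $d$, $B$ is a small set and $a\perp_A B$, then there is $d'$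 with $\mathrm{tp}(d'/Aa)=\mathrm{tp}(d/Aa)$ and $d'\perp_A B$. 3. Non-forking is non-degenerate over $A$: for every tuple $a$, $a\perp_A a$ if and only if all entries of $a$ lie in $\mathrm{acl}(A)$. 4. Non-forking over $A$ is rigid with respect to $\mathrm{acl}$: for all tuples $a,b$, the following are equivalent: $a\perp_A b$; $a\perp_{\mathrm{acl}(A)}b$; $a\perp_A\mathrm{acl}(Ab)$; $\mathrm{acl}(Aa)\perp_A b$; $\mathrm{acl}(Aa)\perp_{\mathrm{acl}(A)}\mathrm{acl}(Ab)$. -/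

import Mathlib

open Cardinal

universe u v w x y

namespace ForkDiv

variable (L : FirstOrder.Language.{u, v}) {M : Type w} [L.Structure M]

/-- `a ≡_B a'`, i.e. `tp(a/B) = tp(a'/B)`, for tuples `a, a'` indexed by `ι`. A formula with
parameters in `B` is an `L`-formula with extra variables from `B`, evaluated at themselves. -/
def SameType (B : Set M) {ι : Type x} (a a' : ι → M) : Prop :=
  ∀ φ : L.Formula (ι ⊕ B),
    φ.Realize (Sum.elim a (fun b : B => (b : M))) ↔ φ.Realize (Sum.elim a' (fun b : B => (b : M)))

/-- `M` is a monster model of `T`, where "small" means "of cardinality less than `κ`": `κ` is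
larger than `|L| + ℵ₀`, and `M` is a `κ`-saturated model of `T`, i.e. every finitely satisfiable
set of formulas in fewer than `κ` variables with fewer than `κ` parameters is realized in `M`. -/
structure IsMonster (T : L.Theory) (M : Type w) [L.Structure M] (κ : Cardinal.{w}) : Prop where
  models : M ⊨ T
  nonempty : Nonempty M
  card_lt : Cardinal.lift.{w} (max ℵ₀ L.card) < Cardinal.lift.{max u v} κ
  saturated : ∀ (B : Set M) (ι : Type w) (Γ : Set (L.Formula (ι ⊕ B))), #B < κ → #ι < κ →
    (∀ Γ₀ : Set (L.Formula (ι ⊕ B)), Γ₀ ⊆ Γ → Γ₀.Finite →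
      ∃ a : ι → M, ∀ φ ∈ Γ₀, φ.Realize (Sum.elim a (fun b : B => (b : M)))) →
    ∃ a : ι → M, ∀ φ ∈ Γ, φ.Realize (Sum.elim a (fun b : B => (b : M)))

variable {L}

/-- The formula `φ(x, b)` divides over `A`: for some `k` there is a sequence `(c i)` of
realizations of `tp(b/A)` such that any `k` of the formulas `φ(x, c i)` are jointly
inconsistent. -/
def Divides (A : Set M) {ι : Type x} {n : ℕ} (φ : L.Formula (ι ⊕ Fin n)) (b : Fin n → M) : Prop :=
  ∃ (k : ℕ) (c : ℕ → Fin n → M), (∀ i, SameType L A (c i) b) ∧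
    ∀ s : Finset ℕ, s.card = k → ¬ ∃ a : ι → M, ∀ i ∈ s, φ.Realize (Sum.elim a (c i))

/-- The formula `φ(x, b)` forks over `A`: it implies a finite disjunction of formulas
`ψ j (x, c j)`, each of which divides over `A`. -/
def Forks (A : Set M) {ι : Type x} {n : ℕ} (φ : L.Formula (ι ⊕ Fin n)) (b : Fin n → M) : Prop :=
  ∃ (m : ℕ) (p : Fin m → ℕ) (ψ : ∀ j, L.Formula (ι ⊕ Fin (p j))) (c : ∀ j, Fin (p j) → M),
    (∀ j, Divides A (ψ j) (c j)) ∧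
    ∀ a : ι → M, φ.Realize (Sum.elim a b) → ∃ j, (ψ j).Realize (Sum.elim a (c j))

variable (L)

/-- Forking equals dividing over `A`. -/
def ForkingEqDividing (A : Set M) : Prop :=
  ∀ (m n : ℕ) (φ : L.Formula (Fin m ⊕ Fin n)) (b : Fin n → M), Forks A φ b ↔ Divides A φ b

/-- Non-forking independence of the tuple `a` from `B` over `C`: no formula in `tp(a/BC)` forks
over `C`. -/
def NonForking {ι : Type x} (a : ι → M) (C B : Set M) : Prop :=
  ∀ (n : ℕ) (φ : L.Formula (ι ⊕ Fin n)) (b : Fin n → M), (∀ i, b i ∈ B ∪ C) →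
    φ.Realize (Sum.elim a b) → ¬ Forks C φ b

/-- `A` is an extension base for non-forking: every tuple is independent from `A` over `A`. -/
def IsExtensionBase (A : Set M) : Prop :=
  ∀ (ι : Type x) (a : ι → M), NonForking L a A A

/-- Non-forking has left extension over `A`: if `a` is independent from `B` over `A` and the
tuple `d` extends `a` as a set, then some `d' ≡_{Aa} d` is independent from `B` over `A`. Here
`B` and `d` (hence `a`) are small. -/
def HasLeftExtension (κ : Cardinal.{w}) (A : Set M) : Prop :=
  ∀ (ι : Type x) (ι' : Type y) (a : ι → M) (d : ι' → M) (B : Set M),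
    #B < κ → #(Set.range d) < κ → Set.range a ⊆ Set.range d → NonForking L a A B →
    ∃ d' : ι' → M, SameType L (A ∪ Set.range a) d' d ∧ NonForking L d' A B

/-- The algebraic closure of `A`: the union of the finite `A`-definable subsets of `M`. -/
def acl (A : Set M) : Set M :=
  {z | ∃ S : Set M, S.Finite ∧ A.Definable₁ L S ∧ z ∈ S}

end ForkDiv

-- Two observations carry the proof: algebraic parameters have finitely many conjugates, and a
-- nonforking type contains no dividing formula, so under forking = dividing a forking configuration
-- can be refuted by building a dividing formula inside the type.
--
-- Extension base: a sequence of conjugates of an algebraic tuple has a constant subsequence, so a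
-- consistent formula with such parameters cannot divide (`not_divides_of_mem_acl`). Conversely,
-- saturation supplies infinitely many distinct conjugates of a nonalgebraic element c, so x = c
-- divides (`NonForking.subset_acl_of_self`).
--
-- Left extension: if it fails, compactness gives θ(z, a) in tp(d/Aa) implying a forking, hence
-- dividing, formula χ(z, b). Then "θ(·, x) is consistent and implies χ(·, y)", which holds of (a,
-- b), divides along the same sequence (`NonForking.exists_extension`).
--
-- Rigidity: forking over A and over acl(A) coincide (`Divides.acl`). On the right, an algebraic
-- parameter is replaced by the disjunction over its conjugates (`NonForking.acl_right`); on the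
-- left, an algebraic tuple is found among boundedly many candidates by pigeonhole
-- (`NonForking.acl_left_fin`).

universe z

namespace ForkDiv

open FirstOrder FirstOrder.Language

/-! ### Types and saturation in terms of definable sets -/

section Definability

variable {L : FirstOrder.Language.{u, v}} {M : Type w} [L.Structure M]

/-- A formula only depends on finitely many of its variables. -/
theorem exists_finset_formula {α : Type x} {β : Type y} (φ : L.Formula (α ⊕ β)) :
    ∃ F : Finset β, ∀ G : Finset β, F ⊆ G → ∃ ψ : L.Formula (α ⊕ G),
      ∀ (a : α → M) (b : β → M),
        ψ.Realize (Sum.elim a (fun i => b i)) ↔ φ.Realize (Sum.elim a b) := by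
  classical
  refine ⟨φ.freeVarFinset.toRight, fun G hG => ?_⟩
  let f : φ.freeVarFinset → α ⊕ G := fun i =>
    match i with
    | ⟨Sum.inl a, _⟩ => Sum.inl a
    | ⟨Sum.inr b, h⟩ => Sum.inr ⟨b, hG (Finset.mem_toRight.2 h)⟩
  refine ⟨φ.restrictFreeVar f, fun a b => ?_⟩
  refine BoundedFormula.realize_restrictFreeVar _ ?_
  rintro ⟨i | i, h⟩ <;> rfl

theorem definable_iff_exists_formula {A : Set M} {α : Type x} {S : Set (α → M)} :
    A.Definable L S ↔
      ∃ φ : L.Formula (α ⊕ A), S = {v | φ.Realize (Sum.elim v (fun a : A => (a : M)))} := by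
  rw [Set.definable_iff_exists_formula_sum]
  constructor
  · rintro ⟨φ, rfl⟩
    refine ⟨φ.relabel Sum.swap, Set.ext fun v => ?_⟩
    simp only [Set.mem_ofPred_eq, Formula.realize_relabel]
    rw [show (Sum.elim v (fun a : A => (a : M))) ∘ Sum.swap = Sum.elim (fun a : A => (a : M)) v by
      ext (i | i) <;> rfl]
  · rintro ⟨φ, rfl⟩
    refine ⟨φ.relabel Sum.swap, Set.ext fun v => ?_⟩
    simp only [Set.mem_ofPred_eq, Formula.realize_relabel]
    rw [show (Sum.elim (fun a : A => (a : M)) v) ∘ Sum.swap = Sum.elim v (fun a : A => (a : M)) by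
      ext (i | i) <;> rfl]

/-- Lets types be handled through definable sets, so that syntactic constructions become closure
properties of `Set.Definable`. -/
theorem sameType_iff {A : Set M} {α : Type x} {a a' : α → M} :
    SameType L A a a' ↔ ∀ S : Set (α → M), A.Definable L S → (a ∈ S ↔ a' ∈ S) := by
  constructor
  · intro h S hS
    obtain ⟨φ, rfl⟩ := definable_iff_exists_formula.1 hS
    exact h φ
  · intro h φ
    exact h _ (definable_iff_exists_formula.2 ⟨φ, rfl⟩)

theorem SameType.mono {A B : Set M} {α : Type x} {a a' : α → M} (h : SameType L B a a')
    (hAB : A ⊆ B) : SameType L A a a' :=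
  sameType_iff.2 fun S hS => sameType_iff.1 h S (hS.mono hAB)

theorem SameType.comp {A : Set M} {α : Type x} {β : Type y} {a a' : α → M}
    (h : SameType L A a a') (f : β → α) : SameType L A (a ∘ f) (a' ∘ f) :=
  sameType_iff.2 fun _ hS => sameType_iff.1 h _ (hS.preimage_comp f)

/-- A set definable by an `L`-formula evaluated at a tuple of parameters from `A`. -/
theorem definable_realize {A : Set M} {α : Type x} {β : Type y} (φ : L.Formula (α ⊕ β))
    (b : β → M) (hb : ∀ i, b i ∈ A) : A.Definable L {v : α → M | φ.Realize (Sum.elim v b)} := by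
  refine definable_iff_exists_formula.2
    ⟨φ.relabel (Sum.map id fun i => ⟨b i, hb i⟩), Set.ext fun v => ?_⟩
  simp only [Set.mem_ofPred_eq, Formula.realize_relabel, Sum.elim_comp_map]
  rfl

theorem definable_setOf_realize {A : Set M} {α : Type x} (φ : L.Formula α) :
    A.Definable L {v : α → M | φ.Realize v} := by
  refine definable_iff_exists_formula.2 ⟨φ.relabel Sum.inl, Set.ext fun v => ?_⟩
  simp [Formula.realize_relabel]

/-- A definable set is defined by an `L`-formula evaluated at a finite tuple of parameters. -/
theorem exists_formula_of_definable {A : Set M} {α : Type x} {S : Set (α → M)}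
    (hS : A.Definable L S) :
    ∃ (n : ℕ) (φ : L.Formula (α ⊕ Fin n)) (b : Fin n → M), (∀ i, b i ∈ A) ∧
      ∀ v, v ∈ S ↔ φ.Realize (Sum.elim v b) := by
  obtain ⟨φ, rfl⟩ := definable_iff_exists_formula.1 hS
  obtain ⟨F, hF⟩ := exists_finset_formula (M := M) φ
  obtain ⟨ψ, hψ⟩ := hF F subset_rfl
  refine ⟨F.card, ψ.relabel (Sum.map id F.equivFin), fun i => ((F.equivFin.symm i : A) : M),
    fun i => Subtype.coe_prop _, fun v => ?_⟩
  rw [Set.mem_ofPred_eq, ← hψ, Formula.realize_relabel, Sum.elim_comp_map]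
  simp [Function.comp_def]

/-- The projection of a definable set is definable, even along infinitely many coordinates. -/
theorem definable_exists [Nonempty M] {A : Set M} {α : Type x} {β : Type y} {S : Set (α ⊕ β → M)}
    (hS : A.Definable L S) : A.Definable L {v : α → M | ∃ z : β → M, Sum.elim v z ∈ S} := by
  classical
  obtain ⟨n, φ, b, hb, h⟩ := exists_formula_of_definable hS
  let r : (α ⊕ β) ⊕ Fin n → (α ⊕ Fin n) ⊕ β :=
    Sum.elim (Sum.map Sum.inl id) (fun i => Sum.inl (Sum.inr i))
  obtain ⟨F, hF⟩ := exists_finset_formula (M := M) (φ.relabel r)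
  obtain ⟨ψ, hψ⟩ := hF F subset_rfl
  convert definable_realize (ψ.iExs F) b hb using 1
  ext v
  have key : ∀ z : β → M, Sum.elim v z ∈ S ↔ ψ.Realize (Sum.elim (Sum.elim v b) fun i => z i) := by
    intro z
    rw [h, hψ, Formula.realize_relabel]
    rw [show Sum.elim (Sum.elim v b) z ∘ r = Sum.elim (Sum.elim v z) b by
      ext ((i | i) | i) <;> rfl]
  simp only [Set.mem_ofPred_eq, Formula.realize_iExs, key]
  constructor
  · rintro ⟨z, hz⟩
    exact ⟨_, hz⟩
  · rintro ⟨z, hz⟩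
    -- Coordinates outside `F` do not occur in the formula, so any value will do there.
    refine ⟨fun i => if hi : i ∈ F then z ⟨i, hi⟩ else Classical.arbitrary M, ?_⟩
    convert hz with i
    simp

theorem definable_forall [Nonempty M] {A : Set M} {α : Type x} {β : Type y} {S : Set (α ⊕ β → M)}
    (hS : A.Definable L S) : A.Definable L {v : α → M | ∀ z : β → M, Sum.elim v z ∈ S} := by
  convert (definable_exists hS.compl).compl using 1
  ext v
  simp

/-- A set definable over `A` and a tuple `a` is a fibre over `a` of an `A`-definable family. -/
theorem exists_definable_family {A : Set M} {α : Type x} {β : Type y} {a : β → M}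
    {S : Set (α → M)} (hS : (A ∪ Set.range a).Definable L S) :
    ∃ R : Set (α ⊕ β → M), A.Definable L R ∧ ∀ v, v ∈ S ↔ Sum.elim v a ∈ R := by
  classical
  obtain ⟨φ, rfl⟩ := definable_iff_exists_formula.1 hS
  have hg : ∀ p : (A ∪ Set.range a : Set M), ∃ q : A ⊕ β, Sum.elim (fun c : A => (c : M)) a q = p := by
    rintro ⟨p, hp | ⟨i, rfl⟩⟩
    · exact ⟨Sum.inl ⟨p, hp⟩, rfl⟩
    · exact ⟨Sum.inr i, rfl⟩
  choose g hg using hg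
  let r : α ⊕ (A ∪ Set.range a : Set M) → (α ⊕ β) ⊕ A := fun i =>
    Sum.elim (fun j => Sum.inl (Sum.inl j))
      (fun p => Sum.elim (fun c => Sum.inr c) (fun j => Sum.inl (Sum.inr j)) (g p)) i
  refine ⟨_, definable_realize (φ.relabel r) (fun c : A => (c : M)) fun c => c.2, fun v => ?_⟩
  simp only [Set.mem_ofPred_eq, Formula.realize_relabel]
  rw [show Sum.elim (Sum.elim v a) (fun c : A => (c : M)) ∘ r =
    Sum.elim v (fun c : (A ∪ Set.range a : Set M) => (c : M)) from ?_]
  ext (i | p)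
  · rfl
  · have := hg p
    simp only [r, Function.comp, Sum.elim_inr]
    rcases hq : g p with q | q <;> rw [hq] at this <;> simpa using this

/-- Saturation, for families of definable sets with the finite intersection property. -/
theorem IsMonster.exists_mem_iInter {T : L.Theory} {κ : Cardinal.{w}} (hM : IsMonster L T M κ)
    {B : Set M} (hB : #B < κ) {ι : Type w} (hι : #ι < κ) {J : Type z} (F : J → Set (ι → M))
    (hF : ∀ j, B.Definable L (F j)) (hfin : ∀ t : Finset J, ∃ a, ∀ j ∈ t, a ∈ F j) :
    ∃ a, ∀ j, a ∈ F j := by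
  classical
  choose φ hφ using fun j => definable_iff_exists_formula.1 (hF j)
  have key : ∀ j a, a ∈ F j ↔ (φ j).Realize (Sum.elim a (fun b : B => (b : M))) := fun j a => by
    rw [hφ j]; rfl
  obtain ⟨a, ha⟩ := hM.saturated B ι (Set.range φ) hB hι fun Γ₀ hΓ₀ hfinΓ => by
    have := hfinΓ.fintype
    choose j hj using fun ψ : Γ₀ => hΓ₀ ψ.2
    obtain ⟨a, ha⟩ := hfin (Finset.univ.image j)
    refine ⟨a, fun ψ hψ => ?_⟩
    have := (key _ a).1 (ha (j ⟨ψ, hψ⟩) (Finset.mem_image_of_mem _ (Finset.mem_univ _)))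
    rwa [hj] at this
  exact ⟨a, fun j => (key j a).2 (ha _ ⟨j, rfl⟩)⟩

end Definability

/-! ### Algebraic closure: size and conjugates -/

section AlgebraicClosure

variable {L : FirstOrder.Language.{u, v}} {M : Type w} [L.Structure M]

theorem mem_acl_iff {A : Set M} {z : M} :
    z ∈ acl L A ↔ ∃ S : Set (Fin 1 → M), S.Finite ∧ A.Definable L S ∧ (fun _ => z) ∈ S := by
  constructor
  · rintro ⟨S, hS, hd, hz⟩
    exact ⟨_, hS.preimage (Equiv.funUnique (Fin 1) M).injective.injOn, hd, hz⟩
  · rintro ⟨S, hS, hd, hz⟩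
    refine ⟨Equiv.funUnique (Fin 1) M '' S, hS.image _, ?_, ⟨_, hz, rfl⟩⟩
    have : {v : Fin 1 → M | v 0 ∈ Equiv.funUnique (Fin 1) M '' S} = S := by
      ext v
      constructor
      · rintro ⟨w, hw, h⟩
        rwa [← (Equiv.funUnique (Fin 1) M).injective h]
      · exact fun h => ⟨v, h, rfl⟩
    rw [Set.Definable₁, this]
    exact hd

theorem subset_acl (A : Set M) : A ⊆ acl L A := fun z hz =>
  mem_acl_iff.2 ⟨{fun _ => z}, Set.finite_singleton _, by
    convert definable_realize (L := L) (A := A) (α := Fin 1)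
      (Term.equal (var (Sum.inl 0)) (var (Sum.inr 0)) : L.Formula (Fin 1 ⊕ Fin 1))
      (fun _ => z) (fun _ => hz) using 1
    ext v
    simp [Formula.realize_equal, funext_iff], rfl⟩

theorem acl_mono {A B : Set M} (h : A ⊆ B) : acl L A ⊆ acl L B := by
  rintro z ⟨S, hS, hd, hz⟩
  exact ⟨S, hS, hd.mono h, hz⟩

/-- There are fewer than κ formulas over A, and each contributes finitely many elements. This keeps
acl(A) small enough for saturation over it. -/
theorem mk_acl_lt {T : L.Theory} {κ : Cardinal.{w}} (hM : IsMonster L T M κ) {A : Set M}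
    (hA : #A < κ) : #(acl L A) < κ := by
  let F : L[[A]].Formula (Fin 1) → Set M := fun φ =>
    {z | {v : Fin 1 → M | φ.Realize v}.Finite ∧ φ.Realize (fun _ => z)}
  have hF : ∀ φ, (F φ).Finite := fun φ => by
    by_cases h : {v : Fin 1 → M | φ.Realize v}.Finite
    · refine Set.Finite.subset (h.image fun v => v 0) ?_
      rintro z ⟨-, hz⟩
      exact ⟨_, hz, rfl⟩
    · refine Set.Finite.subset Set.finite_empty ?_
      rintro z ⟨h', -⟩
      exact h h'
  have hsub : acl L A ⊆ ⋃ φ, F φ := by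
    intro z hz
    obtain ⟨S, hS, ⟨φ, rfl⟩, hz⟩ := mem_acl_iff.1 hz
    exact Set.mem_iUnion.2 ⟨φ, hS, hz⟩
  have hinf : ℵ₀ < κ := by
    have := (le_max_left ℵ₀ L.card)
    have h2 := (Cardinal.lift_le.{w}.2 this).trans_lt hM.card_lt
    simpa using h2
  have hLc : Cardinal.lift.{w} L.card < Cardinal.lift.{max u v} κ :=
    (Cardinal.lift_le.{w}.2 (le_max_right ℵ₀ L.card)).trans_lt hM.card_lt
  have hform : #(L[[A]].Formula (Fin 1)) < Cardinal.lift.{max u v} κ := by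
    have h1 : #(L[[A]].Formula (Fin 1)) ≤ #(Σ n, L[[A]].BoundedFormula (Fin 1) n) :=
      Cardinal.mk_le_of_injective (f := fun φ => ⟨0, φ⟩) fun a b h => by simpa using h
    refine (h1.trans BoundedFormula.card_le).trans_lt ?_
    have hl : ℵ₀ < Cardinal.lift.{max u v} κ := by simpa using hinf
    refine max_lt hl (Cardinal.add_lt_of_lt hl.le ?_ ?_)
    · refine lt_trans ?_ hl
      simp
    · rw [Language.card_withConstants]
      simp only [Cardinal.lift_add, Cardinal.lift_lift]
      refine Cardinal.add_lt_of_lt hl.le ?_ ?_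
      · simpa using hLc
      · simpa using hA
  have hsum : Cardinal.lift.{max u v w} #(acl L A) ≤
      Cardinal.lift.{w} #(L[[A]].Formula (Fin 1)) * ℵ₀ := by
    refine (Cardinal.lift_le.2 (Cardinal.mk_le_mk_of_subset hsub)).trans
      (Cardinal.mk_iUnion_le_sum_mk_lift.trans ?_)
    refine (Cardinal.sum_le_sum _ (fun _ => ℵ₀) fun φ => (hF φ).countable.le_aleph0).trans ?_
    simp
  have hlt : Cardinal.lift.{max u v w} #(acl L A) < Cardinal.lift.{max u v} κ :=
    hsum.trans_lt (Cardinal.mul_lt_of_lt (by simpa using hinf.le)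
      (by rwa [Cardinal.lift_id'.{w, max u v}])
      (by simpa using hinf))
  rw [← Cardinal.lift_umax.{w, max u v}] at hlt
  exact Cardinal.lift_lt.1 hlt

/-- A finite tuple of elements of `acl L A` lies in a finite `A`-definable set all of whose
elements have the same type over `A`. -/
theorem exists_finite_definable {A : Set M} {n : ℕ} {e : Fin n → M} (he : ∀ i, e i ∈ acl L A) :
    ∃ E : Set (Fin n → M), E.Finite ∧ A.Definable L E ∧ e ∈ E ∧ ∀ e' ∈ E, SameType L A e' e := by
  have hex : ∃ E : Set (Fin n → M), E.Finite ∧ A.Definable L E ∧ e ∈ E := by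
    choose S hS hd hz using fun i => mem_acl_iff.1 (he i)
    refine ⟨⋂ i, (fun v : Fin n → M => v ∘ fun _ : Fin 1 => i) ⁻¹' S i, ?_,
      Set.definable_iInter_of_finite fun i => (hd i).preimage_comp _,
      Set.mem_iInter.2 fun i => hz i⟩
    refine Set.Finite.subset (Set.Finite.pi' fun i => (hS i).image fun v => v 0) ?_
    intro v hv i
    exact ⟨_, Set.mem_iInter.1 hv i, rfl⟩
  -- With E of least size, no A-definable set containing e can cut it properly, so E isolates
  -- tp(e/A).
  obtain ⟨E, ⟨hfin, hd, hE⟩, hmin⟩ := (measure (Set.ncard (α := Fin n → M))).wf.has_min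
    {E | E.Finite ∧ A.Definable L E ∧ e ∈ E} hex
  refine ⟨E, hfin, hd, hE, ?_⟩
  have key : ∀ S : Set (Fin n → M), A.Definable L S → e ∈ S → E ⊆ S := by
    intro S hS heS e' he'
    by_contra hne
    refine hmin (E ∩ S) ⟨hfin.subset Set.inter_subset_left, hd.inter hS, hE, heS⟩ ?_
    exact Set.ncard_lt_ncard ⟨Set.inter_subset_left, fun h => hne (h he').2⟩ hfin
  intro e' he'
  refine sameType_iff.2 fun S hS => ⟨fun h => ?_, fun h => key S hS h he'⟩
  by_contra hne
  exact key Sᶜ hS.compl hne he' h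

end AlgebraicClosure

/-! ### Dividing, forking and finitely many variables -/

section Dividing

variable {L : FirstOrder.Language.{u, v}} {M : Type w} [L.Structure M]

/-- Relabelling the object variables of a dividing formula preserves dividing. -/
theorem Divides.of_comp {A : Set M} {ι : Type x} {ι' : Type y} {n : ℕ}
    {φ : L.Formula (ι ⊕ Fin n)} {ψ : L.Formula (ι' ⊕ Fin n)} {b : Fin n → M} (h : Divides A φ b)
    (g : (ι' → M) → ι → M)
    (hg : ∀ a c, ψ.Realize (Sum.elim a c) → φ.Realize (Sum.elim (g a) c)) : Divides A ψ b := by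
  obtain ⟨k, c, hc, hk⟩ := h
  exact ⟨k, c, hc, fun s hs ⟨a, ha⟩ => hk s hs ⟨g a, fun i hi => hg _ _ (ha i hi)⟩⟩

theorem Divides.sameType {A : Set M} {ι : Type x} {n : ℕ} {φ : L.Formula (ι ⊕ Fin n)}
    {b b' : Fin n → M} (h : Divides A φ b) (hb : SameType L A b' b) : Divides A φ b' := by
  obtain ⟨k, c, hc, hk⟩ := h
  exact ⟨k, c, fun i χ => (hc i χ).trans (hb χ).symm, hk⟩

theorem Divides.mono {A B : Set M} {ι : Type x} {n : ℕ} {φ : L.Formula (ι ⊕ Fin n)}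
    {b : Fin n → M} (h : Divides B φ b) (hAB : A ⊆ B) : Divides A φ b := by
  obtain ⟨k, c, hc, hk⟩ := h
  exact ⟨k, c, fun i => (hc i).mono hAB, hk⟩

theorem Divides.forks {A : Set M} {ι : Type x} {n : ℕ} {φ : L.Formula (ι ⊕ Fin n)}
    {b : Fin n → M} (h : Divides A φ b) : Forks A φ b :=
  ⟨1, fun _ => n, fun _ => φ, fun _ => b, fun _ => h, fun _ ha => ⟨0, ha⟩⟩

theorem Forks.of_finite {A : Set M} {ι : Type x} {n : ℕ} {φ : L.Formula (ι ⊕ Fin n)}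
    {b : Fin n → M} {K : Type y} [Finite K] (p : K → ℕ) (ψ : ∀ j, L.Formula (ι ⊕ Fin (p j)))
    (c : ∀ j, Fin (p j) → M) (hd : ∀ j, Divides A (ψ j) (c j))
    (himp : ∀ a : ι → M, φ.Realize (Sum.elim a b) → ∃ j, (ψ j).Realize (Sum.elim a (c j))) :
    Forks A φ b := by
  let e := Finite.equivFin K
  refine ⟨Nat.card K, fun i => p (e.symm i), fun i => ψ (e.symm i), fun i => c (e.symm i),
    fun i => hd _, fun a ha => ?_⟩
  obtain ⟨j, hj⟩ := himp a ha
  obtain ⟨i, rfl⟩ := e.symm.surjective j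
  exact ⟨i, hj⟩

theorem Forks.of_comp {A : Set M} {ι : Type x} {ι' : Type y} {n : ℕ}
    {φ : L.Formula (ι ⊕ Fin n)} {ψ : L.Formula (ι' ⊕ Fin n)} {b : Fin n → M} (h : Forks A φ b)
    (f : ι → ι')
    (hf : ∀ (a : ι' → M) c, ψ.Realize (Sum.elim a c) → φ.Realize (Sum.elim (a ∘ f) c)) :
    Forks A ψ b := by
  obtain ⟨m, p, χ, c, hd, himp⟩ := h
  have key : ∀ j (a : ι' → M) e, ((χ j).relabel (Sum.map f id)).Realize (Sum.elim a e) ↔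
      (χ j).Realize (Sum.elim (a ∘ f) e) := fun j a e => by
    rw [Formula.realize_relabel, Sum.elim_comp_map]; rfl
  refine ⟨m, p, fun j => (χ j).relabel (Sum.map f id), c,
    fun j => (hd j).of_comp (fun a => a ∘ f) fun a e => (key j a e).1, fun a ha => ?_⟩
  obtain ⟨j, hj⟩ := himp _ (hf _ _ ha)
  exact ⟨j, (key j a _).2 hj⟩

theorem NonForking.comp {C B : Set M} {ι : Type x} {ι' : Type y} {a : ι → M}
    (h : NonForking L a C B) (f : ι' → ι) : NonForking L (a ∘ f) C B := by
  intro n φ b hb hφ hfork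
  have key : ∀ (a : ι → M) e, (φ.relabel (Sum.map f id)).Realize (Sum.elim a e) ↔
      φ.Realize (Sum.elim (a ∘ f) e) := fun a e => by
    rw [Formula.realize_relabel, Sum.elim_comp_map]; rfl
  exact h n _ b hb ((key _ _).2 hφ) (hfork.of_comp f fun a e => (key a e).1)

theorem NonForking.mono {C B B' : Set M} {ι : Type x} {a : ι → M}
    (h : NonForking L a C B) (hB : B' ∪ C ⊆ B ∪ C) : NonForking L a C B' :=
  fun n φ b hb => h n φ b fun i => hB (hb i)

/-- A formula only depends on finitely many of its object variables. -/
theorem exists_finset_formula_left {ι : Type x} {q : ℕ} (θ : L.Formula (ι ⊕ Fin q)) :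
    ∃ F : Finset ι, ∀ G : Finset ι, F ⊆ G →
      ∃ θ' : L.Formula (Fin G.card ⊕ Fin q), ∀ (a : ι → M) (e : Fin q → M),
        θ'.Realize (Sum.elim (fun i => a (G.equivFin.symm i)) e) ↔ θ.Realize (Sum.elim a e) := by
  obtain ⟨F, hF⟩ := exists_finset_formula (M := M) (θ.relabel Sum.swap)
  refine ⟨F, fun G hG => ?_⟩
  obtain ⟨ψ, hψ⟩ := hF G hG
  refine ⟨ψ.relabel (Sum.elim Sum.inr fun i => Sum.inl (G.equivFin i)), fun a e => ?_⟩
  have h1 := hψ e a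
  rw [Formula.realize_relabel] at h1 ⊢
  rw [show Sum.elim e a ∘ Sum.swap = Sum.elim a e by ext (i | i) <;> rfl] at h1
  rw [← h1]
  rw [show Sum.elim (fun i => a (G.equivFin.symm i)) e ∘
    (Sum.elim Sum.inr fun i => Sum.inl (G.equivFin i)) = Sum.elim e fun i : G => a i by
      ext (i | i) <;> simp]

/-- If forking equals dividing over `A` for formulas in finitely many variables, then so it does
for formulas in any set of variables. -/
theorem ForkingEqDividing.divides [Nonempty M] {A : Set M} (hA : ForkingEqDividing L A)
    {ι : Type x} {n : ℕ} {φ : L.Formula (ι ⊕ Fin n)} {b : Fin n → M} (h : Forks A φ b) :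
    Divides A φ b := by
  classical
  obtain ⟨m, p, χ, c, hd, himp⟩ := h
  obtain ⟨F, hF⟩ := exists_finset_formula_left (M := M) φ
  choose F' hF' using fun j => exists_finset_formula_left (M := M) (χ j)
  let G := F ∪ Finset.univ.biUnion F'
  obtain ⟨φ', hφ'⟩ := hF G Finset.subset_union_left
  choose χ' hχ' using fun j => hF' j G
    ((Finset.subset_biUnion_of_mem F' (Finset.mem_univ j)).trans Finset.subset_union_right)
  -- `G` supports all the formulas involved; padding outside it by an arbitrary element does not
  -- affect their truth.
  let ext : (Fin G.card → M) → ι → M := fun a i =>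
    if hi : i ∈ G then a (G.equivFin ⟨i, hi⟩) else Classical.arbitrary M
  have hext : ∀ a, (fun i => ext a (G.equivFin.symm i)) = a := fun a => by
    funext i
    simp [ext]
  have hfork : Forks A φ' b := by
    refine ⟨m, p, χ', c, fun j => (hd j).of_comp ext fun a e ha => ?_, fun a ha => ?_⟩
    · rw [← hext a] at ha
      exact (hχ' j _ _).1 ha
    · rw [← hext a] at ha ⊢
      obtain ⟨j, hj⟩ := himp _ ((hφ' _ _).1 ha)
      exact ⟨j, (hχ' j _ _).2 hj⟩
  exact ((hA _ _ _ _).1 hfork).of_comp (fun a i => a (G.equivFin.symm i))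
    fun a e ha => (hφ' _ _).2 ha

/-- Pulling a sequence back along an injection preserves `k`-inconsistency. -/
theorem inconsistent_comp {X : Type x} {k : ℕ} {P : X → ℕ → Prop}
    (h : ∀ s : Finset ℕ, s.card = k → ¬ ∃ a, ∀ i ∈ s, P a i) {g : ℕ → ℕ}
    (hg : Function.Injective g) :
    ∀ s : Finset ℕ, s.card = k → ¬ ∃ a, ∀ i ∈ s, P a (g i) := by
  classical
  rintro s hs ⟨a, ha⟩
  refine h (s.image g) (by rw [Finset.card_image_of_injective _ hg, hs]) ⟨a, fun i hi => ?_⟩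
  obtain ⟨j, hj, rfl⟩ := Finset.mem_image.1 hi
  exact ha j hj

/-- A sequence in a finite set is constant along an injection. -/
theorem exists_injective_const {X : Type x} {E : Set X} (hE : E.Finite) {c : ℕ → X}
    (hc : ∀ i, c i ∈ E) : ∃ g : ℕ → ℕ, Function.Injective g ∧ ∃ e ∈ E, ∀ i, c (g i) = e := by
  have := hE.to_subtype
  obtain ⟨⟨e, he⟩, hinf⟩ := Finite.exists_infinite_fiber fun i => (⟨c i, hc i⟩ : E)
  rw [Set.infinite_coe_iff] at hinf
  refine ⟨fun i => hinf.natEmbedding _ i, fun i j h => ?_, e, he, fun i => ?_⟩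
  · exact (hinf.natEmbedding _).injective (Subtype.ext h)
  · exact congrArg Subtype.val (show _ = _ from (hinf.natEmbedding _ i).2)

/-- A consistent formula with algebraic parameters does not divide. -/
theorem not_divides_of_mem_acl [Nonempty M] {A : Set M} {ι : Type x} {n : ℕ}
    {φ : L.Formula (ι ⊕ Fin n)} {a : ι → M} {b : Fin n → M} (hb : ∀ i, b i ∈ acl L A)
    (h : φ.Realize (Sum.elim a b)) : ¬ Divides A φ b := by
  rintro ⟨k, c, hc, hk⟩
  obtain ⟨E, hfin, hd, hbE, -⟩ := exists_finite_definable hb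
  obtain ⟨g, hg, e, -, he⟩ := exists_injective_const hfin
    fun i => (sameType_iff.1 (hc i) E hd).2 hbE
  have hdef : A.Definable L {y : Fin n → M | ∃ z : ι → M, φ.Realize (Sum.elim z y)} := by
    convert definable_exists (definable_setOf_realize (A := A) (φ.relabel Sum.swap)) using 5
      with y z
    rw [Set.mem_ofPred_eq, Formula.realize_relabel,
      show Sum.elim y z ∘ Sum.swap = Sum.elim z y by ext (i | i) <;> rfl]
  obtain ⟨z, hz⟩ : ∃ z : ι → M, φ.Realize (Sum.elim z e) := by
    have := (sameType_iff.1 (hc (g 0)) _ hdef).2 ⟨a, h⟩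
    rwa [he 0] at this
  refine inconsistent_comp hk hg (Finset.range k) (Finset.card_range k) ⟨z, fun i _ => ?_⟩
  rwa [he i]

theorem nonForking_of_subset_acl [Nonempty M] {A B : Set M} (hFD : ForkingEqDividing L A)
    (hB : B ⊆ acl L A) {ι : Type x} (a : ι → M) : NonForking L a A B := fun _ _ _ hb h hf =>
  not_divides_of_mem_acl (fun i => (hb i).elim (fun h => hB h) fun h => subset_acl A h) h
    (hFD.divides hf)

/-- A fibre of an `A`-definable family that divides over `A` contains no realization of a
nonforking type. -/
theorem NonForking.not_mem_of_divides {A B : Set M} {ι : Type x} {a : ι → M}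
    (h : NonForking L a A B) {n : ℕ} {R : Set (ι ⊕ Fin n → M)} (hR : A.Definable L R)
    {b : Fin n → M} (hb : ∀ i, b i ∈ B ∪ A) {k : ℕ} {c : ℕ → Fin n → M}
    (hc : ∀ i, SameType L A (c i) b)
    (hk : ∀ s : Finset ℕ, s.card = k → ¬ ∃ a : ι → M, ∀ i ∈ s, Sum.elim a (c i) ∈ R) :
    Sum.elim a b ∉ R := by
  intro hab
  obtain ⟨m, φ, e, he, hφ⟩ := exists_formula_of_definable hR
  -- The parameters e of R lie in A, so they can be appended to b and kept fixed along the sequence: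
  -- (c i, e) still realizes tp(b, e / A).
  let r : (ι ⊕ Fin n) ⊕ Fin m → ι ⊕ Fin (n + m) :=
    Sum.elim (Sum.map id (Fin.castAdd m)) fun i => Sum.inr (Fin.natAdd n i)
  have key : ∀ z y, (φ.relabel r).Realize (Sum.elim z (Fin.append y e)) ↔ Sum.elim z y ∈ R := by
    intro z y
    rw [hφ, Formula.realize_relabel,
      show Sum.elim z (Fin.append y e) ∘ r = Sum.elim (Sum.elim z y) e by
        ext ((i | i) | i) <;> simp [r] ]
  refine h _ (φ.relabel r) (Fin.append b e) ?_ ((key _ _).2 hab) (Divides.forks ?_)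
  · intro i
    refine Fin.addCases (fun i => ?_) (fun i => ?_) i
    · simpa using hb i
    · simpa using Or.inr (he i)
  · refine ⟨k, fun i => Fin.append (c i) e, fun i => sameType_iff.2 fun S hS => ?_,
      fun s hs ⟨z, hz⟩ => hk s hs ⟨z, fun i hi => (key _ _).1 (hz i hi)⟩⟩
    obtain ⟨q, χ, d, hd, hχ⟩ := exists_formula_of_definable hS
    have hdef : A.Definable L {y : Fin n → M | Fin.append y e ∈ S} := by
      let t : Fin (n + m) ⊕ Fin q → Fin n ⊕ (Fin m ⊕ Fin q) :=
        Sum.elim (fun i => Fin.addCases (fun i => Sum.inl i) (fun i => Sum.inr (Sum.inl i)) i)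
          fun i => Sum.inr (Sum.inr i)
      convert definable_realize (A := A) (χ.relabel t) (Sum.elim e d) (by
        rintro (i | i)
        exacts [he i, hd i]) using 1
      ext y
      rw [Set.mem_ofPred_eq, Set.mem_ofPred_eq, hχ, Formula.realize_relabel]
      congr! 1
      ext (i | i)
      · refine Fin.addCases (fun i => ?_) (fun i => ?_) i <;> simp [t]
      · rfl
    exact sameType_iff.1 (hc i) _ hdef

end Dividing

/-! ### Consequences of saturation: change of base and non-degeneracy -/

section Monster

variable {L : FirstOrder.Language.{u, v}} {M : Type w} [L.Structure M]
  {T : L.Theory} {κ : Cardinal.{w}}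

theorem IsMonster.aleph0_lt (hM : IsMonster L T M κ) : ℵ₀ < κ := by
  have h := (Cardinal.lift_le.{w}.2 (le_max_left ℵ₀ L.card)).trans_lt hM.card_lt
  simpa using h

theorem IsMonster.mk_union_lt (hM : IsMonster L T M κ) {A B : Set M} (hA : #A < κ) (hB : #B < κ) :
    #(A ∪ B : Set M) < κ :=
  (Cardinal.mk_union_le A B).trans_lt (Cardinal.add_lt_of_lt hM.aleph0_lt.le hA hB)

/-- Dividing over `A` implies dividing over its algebraic closure. -/
theorem Divides.acl (hM : IsMonster L T M κ) {A : Set M} (hA : #A < κ) {ι : Type x} {n : ℕ}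
    {φ : L.Formula (ι ⊕ Fin n)} {b : Fin n → M} (h : Divides A φ b) :
    Divides (acl L A) φ b := by
  classical
  have := hM.nonempty
  obtain ⟨k, c, hc, hk⟩ := h
  let emb : ℕ → Fin n → ULift.{w} (ℕ × Fin n) := fun i j => ⟨(i, j)⟩
  -- The unknown is a whole sequence of tuples: each must realize tp(b/acl(A)), and every k of them
  -- must give inconsistent instances.
  let J := (ℕ × {S : Set (Fin n → M) // (ForkDiv.acl L A).Definable L S ∧ b ∈ S}) ⊕
    {s : Finset ℕ // s.card = k}
  let N : Finset ℕ → Set (ULift.{w} (ℕ × Fin n) → M) := fun s =>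
    {d | ¬ ∃ z : ι → M, ∀ i ∈ s, φ.Realize (Sum.elim z (d ∘ emb i))}
  have hN : ∀ s, A.Definable L (N s) := fun s => by
    let r : ℕ → ι ⊕ Fin n → ULift.{w} (ℕ × Fin n) ⊕ ι := fun i =>
      Sum.elim Sum.inr fun j => Sum.inl (emb i j)
    convert (definable_exists (Set.definable_biInter_finset
      (fun i => (definable_setOf_realize (A := A) φ).preimage_comp (r i)) s)).compl using 1
    ext d
    have : ∀ i z, Sum.elim d z ∘ r i = Sum.elim z (d ∘ emb i) := fun i z => by
      ext (j | j) <;> rfl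
    simp [N, this]
  let F : J → Set (ULift.{w} (ℕ × Fin n) → M) :=
    Sum.elim (fun p => (fun d => d ∘ emb p.1) ⁻¹' p.2.1) fun s => N s.1
  have hmk : #(ULift.{w} (ℕ × Fin n)) < κ :=
    (Cardinal.mk_le_aleph0 (α := ULift.{w} (ℕ × Fin n))).trans_lt hM.aleph0_lt
  have hdef : ∀ j, (ForkDiv.acl L A).Definable L (F j) := by
    rintro (p | s)
    · exact p.2.2.1.preimage_comp _
    · exact (hN _).mono (subset_acl A)
  have hfip : ∀ t : Finset _, ∃ d, ∀ j ∈ t, d ∈ F j := by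
    intro t
    -- All the type conditions in `t` are merged into one formula ψ(y, e), with e algebraic over A,
    -- to be imposed on every tuple of the sequence.
    let U : J → Set (Fin n → M) := Sum.elim (fun p => p.2.1) fun _ => Set.univ
    have hU : (ForkDiv.acl L A).Definable L (⋂ j ∈ t, U j) := by
      refine Set.definable_biInter_finset ?_ t
      rintro (p | s)
      exacts [p.2.2.1, Set.definable_univ]
    have hbU : b ∈ ⋂ j ∈ t, U j := by
      simp only [Set.mem_iInter]
      rintro (p | s) -
      exacts [p.2.2.2, Set.mem_univ _]
    obtain ⟨m, ψ, e, he, hψ⟩ := exists_formula_of_definable hU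
    obtain ⟨E, hfin, hE, heE, hconj⟩ := exists_finite_definable he
    let r : ℕ → Fin n ⊕ Fin m → Fin m ⊕ ULift.{w} (ℕ × Fin n) := fun i =>
      Sum.elim (fun j => Sum.inr (emb i j)) Sum.inl
    let V : J → Set (Fin m ⊕ ULift.{w} (ℕ × Fin n) → M) :=
      Sum.elim (fun p => (fun v => v ∘ r p.1) ⁻¹' {v | ψ.Realize v})
        fun s => (fun v => v ∘ Sum.inr) ⁻¹' N s.1
    have hr : ∀ i (z : Fin m → M) d, Sum.elim z d ∘ r i = Sum.elim (d ∘ emb i) z := fun i z d => by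
      ext (j | j) <;> rfl
    have hV : A.Definable L {z : Fin m → M | ∃ d, Sum.elim z d ∈ ⋂ j ∈ t, V j} := by
      refine definable_exists (Set.definable_biInter_finset ?_ t)
      rintro (p | s)
      · exact (definable_setOf_realize ψ).preimage_comp _
      · exact (hN _).preimage_comp _
    -- Since c i has only the type of b over A, it satisfies ψ(y, z) for some conjugate z of e,
    -- possibly depending on i.
    have hcE : ∀ i, ∃ z ∈ E, ψ.Realize (Sum.elim (c i) z) := by
      have hdef : A.Definable L {y : Fin n → M | ∃ z, Sum.elim y z ∈
          {v : Fin n ⊕ Fin m → M | ψ.Realize v} ∩ (fun v => v ∘ Sum.inr) ⁻¹' E} :=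
        definable_exists ((definable_setOf_realize ψ).inter (hE.preimage_comp _))
      intro i
      obtain ⟨z, hz, hzE⟩ := (sameType_iff.1 (hc i) _ hdef).2 ⟨e, (hψ b).1 hbU, heE⟩
      exact ⟨z, hzE, hz⟩
    choose z hzE hz using hcE
    -- Pigeonhole makes the conjugate constant on a subsequence. The existence of a suitable
    -- sequence is an A-definable property of this e', so it passes to e.
    obtain ⟨g, hg, e', he'E, he'⟩ := exists_injective_const hfin hzE
    obtain ⟨d, hd⟩ := (sameType_iff.1 (hconj e' he'E) _ hV).1 ⟨fun p => c (g p.down.1) p.down.2, by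
      simp only [Set.mem_iInter]
      rintro (p | s) -
      · change ψ.Realize (Sum.elim e' _ ∘ r p.1)
        rw [hr, ← he' p.1]
        exact hz (g p.1)
      · exact inconsistent_comp hk hg s.1 s.2⟩
    refine ⟨d, fun j hj => ?_⟩
    have hdj := Set.mem_iInter₂.1 hd j hj
    rcases j with p | s
    · have : ψ.Realize (Sum.elim (d ∘ emb p.1) e) := by
        rw [← hr]
        exact hdj
      exact Set.mem_iInter₂.1 ((hψ _).2 this) _ hj
    · exact hdj
  obtain ⟨d, hd⟩ := hM.exists_mem_iInter (mk_acl_lt hM hA) hmk F hdef hfip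
  exact ⟨k, fun i => d ∘ emb i, fun i => sameType_iff.2 fun S hS => ⟨fun h => by
    by_contra hb
    exact hd (Sum.inl (i, ⟨Sᶜ, hS.compl, hb⟩)) h, fun hb => hd (Sum.inl (i, ⟨S, hS, hb⟩))⟩,
    fun s hs => hd (Sum.inr ⟨s, hs⟩)⟩

theorem forks_acl_iff (hM : IsMonster L T M κ) {A : Set M} (hA : #A < κ) {ι : Type x} {n : ℕ}
    {φ : L.Formula (ι ⊕ Fin n)} {b : Fin n → M} : Forks (acl L A) φ b ↔ Forks A φ b :=
  ⟨fun ⟨m, p, ψ, c, hd, h⟩ => ⟨m, p, ψ, c, fun j => (hd j).mono (subset_acl A), h⟩,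
    fun ⟨m, p, ψ, c, hd, h⟩ => ⟨m, p, ψ, c, fun j => (hd j).acl hM hA, h⟩⟩

/-- Forking is the same over both bases, so only the sets of allowed parameters have to be compared.
-/
theorem nonForking_acl_iff (hM : IsMonster L T M κ) {A B : Set M} (hA : #A < κ) {ι : Type x}
    {a : ι → M} : NonForking L a (acl L A) B ↔ NonForking L a A (B ∪ acl L A) := by
  have : B ∪ acl L A ∪ A = B ∪ acl L A :=
    Set.union_eq_left.2 ((subset_acl A).trans Set.subset_union_right)
  simp only [NonForking, forks_acl_iff hM hA, this]

/-- Non-forking is anti-reflexive outside the algebraic closure. -/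
theorem NonForking.subset_acl_of_self (hM : IsMonster L T M κ) {A : Set M} (hA : #A < κ)
    {ι : Type x} {a : ι → M} (h : NonForking L a A (Set.range a)) : Set.range a ⊆ acl L A := by
  classical
  rintro _ ⟨i₀, rfl⟩
  by_contra hacl
  let J := (ℕ × {S : Set (Fin 1 → M) // A.Definable L S ∧ (fun _ => a i₀) ∈ S}) ⊕
    {p : ℕ × ℕ // p.1 ≠ p.2}
  let emb : ℕ → Fin 1 → ULift.{w} ℕ := fun i _ => ⟨i⟩
  let F : J → Set (ULift.{w} ℕ → M) :=
    Sum.elim (fun p => (fun d => d ∘ emb p.1) ⁻¹' p.2.1) fun p => {d | d ⟨p.1.1⟩ ≠ d ⟨p.1.2⟩}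
  have hdef : ∀ j, A.Definable L (F j) := by
    rintro (p | p)
    · exact p.2.2.1.preimage_comp _
    · convert (definable_setOf_realize (A := A) (Term.equal (var ⟨p.1.1⟩) (var ⟨p.1.2⟩) :
        L.Formula (ULift.{w} ℕ))).compl using 1
      ext d
      simp [F, Formula.realize_equal]
  have hfip : ∀ t : Finset _, ∃ d, ∀ j ∈ t, d ∈ F j := by
    intro t
    let U : J → Set (Fin 1 → M) := Sum.elim (fun p => p.2.1) fun _ => Set.univ
    have hU : A.Definable L (⋂ j ∈ t, U j) := by
      refine Set.definable_biInter_finset ?_ t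
      rintro (p | s)
      exacts [p.2.2.1, Set.definable_univ]
    have hbU : (fun _ => a i₀) ∈ ⋂ j ∈ t, U j := by
      simp only [Set.mem_iInter]
      rintro (p | s) -
      exacts [p.2.2.2, Set.mem_univ _]
    -- A finite intersection would witness that a i₀ is algebraic; an infinite one provides distinct
    -- elements meeting every condition in `t`.
    have hinf : (⋂ j ∈ t, U j).Infinite := fun hfin => hacl (mem_acl_iff.2 ⟨_, hfin, hU, hbU⟩)
    refine ⟨fun i => (hinf.natEmbedding _ i.down : Fin 1 → M) 0, ?_⟩
    rintro (p | p) hj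
    · have := Set.mem_iInter₂.1 (hinf.natEmbedding _ p.1).2 _ hj
      convert (this : _ ∈ p.2.1) using 1
      change _ ∈ p.2.1 ↔ _
      rw [iff_iff_eq]
      congr 1
      funext i
      rw [Subsingleton.elim i 0]
      rfl
    · intro h
      refine p.2 ((hinf.natEmbedding _).injective (Subtype.ext (funext fun i => ?_)))
      rw [Subsingleton.elim i 0]
      exact h
  obtain ⟨d, hd⟩ := hM.exists_mem_iInter hA
    (show #(ULift.{w} ℕ) < κ by simpa using hM.aleph0_lt) F hdef hfip
  refine h 1 (Term.equal (var (Sum.inl i₀)) (var (Sum.inr 0))) (fun _ => a i₀)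
    (fun _ => Or.inl ⟨i₀, rfl⟩) (by simp [Formula.realize_equal]) (Divides.forks ?_)
  refine ⟨2, fun i => d ∘ emb i, fun i => sameType_iff.2 fun S hS => ⟨fun h => by
    by_contra hb
    exact hd (Sum.inl (i, ⟨Sᶜ, hS.compl, hb⟩)) h, fun hb => hd (Sum.inl (i, ⟨S, hS, hb⟩))⟩, ?_⟩
  rintro s hs ⟨z, hz⟩
  obtain ⟨i, j, hij, rfl⟩ := Finset.card_eq_two.1 hs
  have hi := hz i (by simp)
  have hj := hz j (by simp)
  simp only [Formula.realize_equal, Term.realize_var, Sum.elim_inl, Sum.elim_inr] at hi hj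
  exact hd (Sum.inr ⟨(i, j), hij⟩) (hi.symm.trans hj)

end Monster

/-! ### Closure of independence under acl, and left extension -/

section Independence

variable {L : FirstOrder.Language.{u, v}} {M : Type w} [L.Structure M]
  {T : L.Theory} {κ : Cardinal.{w}}

/-- If φ(x, e) divides over A, so does φ(x, e') for each of the finitely many e' in an AB-definable
set isolating tp(e/AB). Hence "φ(x, z) for some such z", a formula over AB true of a, forks. -/
theorem NonForking.acl_right [Nonempty M] {A B : Set M} (hFD : ForkingEqDividing L A) {ι : Type x}
    {a : ι → M} (h : NonForking L a A B) : NonForking L a A (acl L (A ∪ B)) := by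
  intro n φ e he hφ hfork
  have hdiv := hFD.divides hfork
  obtain ⟨E, hfin, hE, heE, hconj⟩ := exists_finite_definable (L := L) (A := A ∪ B) (e := e)
    fun i => (he i).elim id fun h => subset_acl _ (Or.inl h)
  have hS : (A ∪ B).Definable L {x : ι → M | ∃ z : Fin n → M, Sum.elim x z ∈
      {v : ι ⊕ Fin n → M | φ.Realize v} ∩ (fun v => v ∘ Sum.inr) ⁻¹' E} :=
    definable_exists ((definable_setOf_realize φ).inter (hE.preimage_comp _))
  obtain ⟨m, χ, b, hb, hχ⟩ := exists_formula_of_definable hS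
  refine h m χ b (fun i => (hb i).symm) ((hχ a).1 ⟨e, hφ, heE⟩) ?_
  have := hfin.to_subtype
  refine Forks.of_finite (K := E) (fun _ => n) (fun _ => φ) (fun z => z.1)
    (fun z => hdiv.sameType ((hconj z.1 z.2).mono Set.subset_union_left)) fun x hx => ?_
  obtain ⟨z, hz, hzE⟩ := (hχ x).2 hx
  exact ⟨⟨z, hzE⟩, hz⟩

/-- Finite character of non-forking on the left. -/
theorem nonForking_of_finite [Nonempty M] {A B : Set M} (hFD : ForkingEqDividing L A) {ι : Type x}
    {a : ι → M} (h : ∀ (m : ℕ) (f : Fin m → ι), NonForking L (a ∘ f) A B) :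
    NonForking L a A B := by
  classical
  intro n φ b hb hφ hfork
  obtain ⟨F, hF⟩ := exists_finset_formula_left (M := M) φ
  obtain ⟨ψ, hψ⟩ := hF F subset_rfl
  refine h _ (fun i => F.equivFin.symm i) n ψ b hb ((hψ _ _).2 hφ) (Divides.forks ?_)
  refine (hFD.divides hfork).of_comp
    (fun a i => if hi : i ∈ F then a (F.equivFin ⟨i, hi⟩) else Classical.arbitrary M) fun a c ha =>
      (hψ _ _).1 ?_
  convert ha using 2
  funext i
  simp

/-- The fibres of a definable family that are covered by `r` tuples form a definable set. -/
theorem definable_covered [Nonempty M] {A : Set M} {ι : Type x} {m : ℕ} (r : ℕ)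
    {R : Set (Fin m ⊕ ι → M)} (hR : A.Definable L R) :
    A.Definable L {v : ι → M | ∃ w : Fin r × Fin m → M, ∀ z : Fin m → M,
      Sum.elim z v ∈ R → ∃ i, ∀ j, z j = w (i, j)} := by
  let g : Fin m ⊕ ι → (ι ⊕ Fin r × Fin m) ⊕ Fin m :=
    Sum.elim Sum.inr fun i => Sum.inl (Sum.inl i)
  convert definable_exists (definable_forall ((hR.preimage_comp g).compl.union
    (Set.definable_iUnion_of_finite fun i => Set.definable_iInter_of_finite fun j =>
      definable_setOf_realize (A := A) (Term.equal (var (Sum.inr j)) (var (Sum.inl (Sum.inr (i, j)))) :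
        L.Formula ((ι ⊕ Fin r × Fin m) ⊕ Fin m))))) using 1
  ext v
  have : ∀ (w : Fin r × Fin m → M) z, Sum.elim (Sum.elim v w) z ∘ g = Sum.elim z v := fun w z => by
    ext (i | i) <;> rfl
  simp [this, Formula.realize_equal, imp_iff_not_or]

/-- Let R be an A-definable family whose fibre at a is finite and contains e, and let φ(z, b)
divide. Then "the fibre at x has at most r elements, one of which satisfies φ(z, y)" divides: a
single x serving many c i has one candidate z serving k of them. -/
theorem NonForking.acl_left_fin [Nonempty M] {A B : Set M} (hFD : ForkingEqDividing L A)
    {ι : Type x} {a : ι → M} (h : NonForking L a A B) {m : ℕ} {e : Fin m → M}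
    (he : ∀ i, e i ∈ acl L (A ∪ Set.range a)) : NonForking L e A B := by
  classical
  intro n φ b hb hφ hfork
  obtain ⟨k, c, hc, hk⟩ := hFD.divides hfork
  obtain ⟨E, hfin, hE, heE, -⟩ := exists_finite_definable he
  obtain ⟨R, hR, hER⟩ := exists_definable_family hE
  let r := hfin.toFinset.card
  let Q : Set (ι → M) := {v | ∃ w : Fin r × Fin m → M, ∀ z : Fin m → M,
      Sum.elim z v ∈ R → ∃ i, ∀ j, z j = w (i, j)}
  let g : Fin m ⊕ ι → (ι ⊕ Fin n) ⊕ Fin m := Sum.elim Sum.inr fun i => Sum.inl (Sum.inl i)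
  let g' : Fin m ⊕ Fin n → (ι ⊕ Fin n) ⊕ Fin m := Sum.elim Sum.inr fun i => Sum.inl (Sum.inr i)
  have hg : ∀ (x : ι → M) (y : Fin n → M) z, Sum.elim (Sum.elim x y) z ∘ g = Sum.elim z x :=
    fun x y z => by ext (i | i) <;> rfl
  have hg' : ∀ (x : ι → M) (y : Fin n → M) z, Sum.elim (Sum.elim x y) z ∘ g' = Sum.elim z y :=
    fun x y z => by ext (i | i) <;> rfl
  have hdef := ((definable_covered (A := A) r hR).preimage_comp
    (Sum.inl : ι → ι ⊕ Fin n)).inter (definable_exists ((hR.preimage_comp g).inter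
      ((definable_setOf_realize (A := A) φ).preimage_comp g')))
  -- More than r * k indices distributed over r candidates put at least k on one candidate; the
  -- extra 1 also makes the index set nonempty, so that a cover exists.
  refine h.not_mem_of_divides hdef hb hc (k := r * k + 1) ?_ ⟨?_, e, ?_, ?_⟩
  · rintro s hs ⟨x, hx⟩
    have hx' : ∀ i ∈ s, x ∈ Q ∧ ∃ z, Sum.elim z x ∈ R ∧ φ.Realize (Sum.elim z (c i)) := by
      intro i hi
      obtain ⟨h1, z, h2, h3⟩ := hx i hi
      refine ⟨h1, z, ?_, ?_⟩
      · rwa [Set.mem_preimage, hg] at h2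
      · rwa [Set.mem_preimage, hg'] at h3
    obtain ⟨i₀, hi₀⟩ : s.Nonempty := Finset.card_pos.1 (by omega)
    obtain ⟨w, hw⟩ := (hx' i₀ hi₀).1
    have hcol : ∀ i ∈ s, ∃ j : Fin r, φ.Realize (Sum.elim (fun l => w (j, l)) (c i)) := by
      intro i hi
      obtain ⟨z, hz, hzφ⟩ := (hx' i hi).2
      obtain ⟨j, hj⟩ := hw z hz
      exact ⟨j, by rwa [← funext hj]⟩
    have hr : 0 < r := Finset.card_pos.2 ⟨e, by simpa using heE⟩
    choose! f hf using (fun i hi => ⟨(hcol i hi).choose.1, (hcol i hi).choose.2,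
      (hcol i hi).choose_spec⟩ : ∀ i ∈ s, ∃ (j : ℕ) (hj : j < r),
        φ.Realize (Sum.elim (fun l => w (⟨j, hj⟩, l)) (c i)))
    obtain ⟨j, hj, hcard⟩ := Finset.exists_lt_card_fiber_of_mul_lt_card_of_maps_to
      (s := s) (t := Finset.range r) (f := f) (n := k)
      (fun i hi => Finset.mem_range.2 (hf i hi).1) (by simp [hs])
    obtain ⟨s', hs', hs'k⟩ := Finset.exists_subset_card_eq hcard.le
    refine hk s' hs'k ⟨fun l => w (⟨j, Finset.mem_range.1 hj⟩, l), fun i hi => ?_⟩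
    obtain ⟨his, rfl⟩ := Finset.mem_filter.1 (hs' hi)
    exact (hf i his).2
  · let q := hfin.toFinset.equivFin
    refine ⟨fun p => (q.symm p.1 : Fin m → M) p.2, fun z hz => ?_⟩
    have hzE : z ∈ hfin.toFinset := by simpa using (hER z).2 hz
    exact ⟨q ⟨z, hzE⟩, fun j => by simp⟩
  · rw [Set.mem_preimage, hg]
    exact (hER e).1 heE
  · rw [Set.mem_preimage, hg']
    exact hφ

theorem NonForking.acl_left [Nonempty M] {A B : Set M} (hFD : ForkingEqDividing L A) {ι : Type x}
    {a : ι → M} (h : NonForking L a A B) :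
    NonForking L (fun z : acl L (A ∪ Set.range a) => (z : M)) A B :=
  nonForking_of_finite hFD fun _ f => h.acl_left_fin hFD fun i => (f i).2

/-- Left extension, for a small tuple `d` that need not extend `a`. -/
theorem NonForking.exists_extension (hM : IsMonster L T M κ) {A B : Set M} (hA : #A < κ)
    (hB : #B < κ) (hFD : ForkingEqDividing L A) {ι : Type x} {a : ι → M}
    (ha : #(Set.range a) < κ) (h : NonForking L a A B) {ι' : Type w} (hι' : #ι' < κ)
    (d : ι' → M) :
    ∃ d' : ι' → M, SameType L (A ∪ Set.range a) d' d ∧ NonForking L d' A B := by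
  classical
  have := hM.nonempty
  -- `J₁` is tp(d/Aa) and `J₂` lists the forking formulas to be avoided; their joint realization is
  -- the required d'.
  let J₁ := {S : Set (ι' → M) // (A ∪ Set.range a).Definable L S ∧ d ∈ S}
  let J₂ := {p : Σ n : ℕ, L.Formula (ι' ⊕ Fin n) × (Fin n → M) //
    (∀ i, p.2.2 i ∈ B ∪ A) ∧ Forks A p.2.1 p.2.2}
  let X : J₂ → Set (ι' → M) := fun p => {z | p.1.2.1.Realize (Sum.elim z p.1.2.2)}
  have hX : ∀ p, (B ∪ A).Definable L (X p) := fun p => definable_realize _ _ p.2.1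
  let F : J₁ ⊕ J₂ → Set (ι' → M) := Sum.elim (fun S => S.1) fun p => (X p)ᶜ
  have hdef : ∀ j, ((A ∪ Set.range a) ∪ (B ∪ A)).Definable L (F j) := by
    rintro (S | p)
    · exact S.2.1.mono Set.subset_union_left
    · exact (hX p).compl.mono Set.subset_union_right
  have hfip : ∀ t : Finset _, ∃ d, ∀ j ∈ t, d ∈ F j := by
    intro t
    by_contra! hcon
    let U : J₁ ⊕ J₂ → Set (ι' → M) := Sum.elim (fun S => S.1) fun _ => Set.univ
    let V : J₁ ⊕ J₂ → Set (ι' → M) := Sum.elim (fun _ => ∅) X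
    have hU : (A ∪ Set.range a).Definable L (⋂ j ∈ t, U j) := by
      refine Set.definable_biInter_finset ?_ t
      rintro (S | p)
      exacts [S.2.1, Set.definable_univ]
    have hdU : d ∈ ⋂ j ∈ t, U j := by
      simp only [Set.mem_iInter]
      rintro (S | p) -
      exacts [S.2.2, Set.mem_univ _]
    have hV : (B ∪ A).Definable L (⋃ j ∈ t, V j) := by
      refine Set.definable_biUnion_finset ?_ t
      rintro (S | p)
      exacts [Set.definable_empty, hX p]
    have hUV : ∀ z ∈ ⋂ j ∈ t, U j, z ∈ ⋃ j ∈ t, V j := by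
      intro z hz
      obtain ⟨j, hj, hzj⟩ := hcon z
      refine Set.mem_iUnion₂.2 ⟨j, hj, ?_⟩
      rcases j with S | p
      · exact absurd (Set.mem_iInter₂.1 hz _ hj) hzj
      · exact not_not.1 hzj
    obtain ⟨n, χ, b, hb, hχ⟩ := exists_formula_of_definable hV
    have hfork : Forks A χ b := by
      have : Finite {p : J₂ // Sum.inr p ∈ t} := Finite.of_injective
        (fun p => (⟨Sum.inr p.1, p.2⟩ : t)) fun p q hpq => by
          simpa [Subtype.ext_iff] using hpq
      refine Forks.of_finite (K := {p : J₂ // Sum.inr p ∈ t}) (fun p => p.1.1.1)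
        (fun p => p.1.1.2.1) (fun p => p.1.1.2.2) (fun p => hFD.divides p.1.2.2) fun z hz => ?_
      obtain ⟨j, hj, hzj⟩ := Set.mem_iUnion₂.1 ((hχ z).2 hz)
      rcases j with S | p
      · exact hzj.elim
      · exact ⟨⟨p, hj⟩, hzj⟩
    obtain ⟨k, c, hc, hk⟩ := hFD.divides hfork
    obtain ⟨R, hR, hUR⟩ := exists_definable_family hU
    let g : ι' ⊕ ι → (ι ⊕ Fin n) ⊕ ι' := Sum.elim Sum.inr fun i => Sum.inl (Sum.inl i)
    let g' : ι' ⊕ Fin n → (ι ⊕ Fin n) ⊕ ι' := Sum.elim Sum.inr fun i => Sum.inl (Sum.inr i)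
    have hg : ∀ (x : ι → M) (y : Fin n → M) z, Sum.elim (Sum.elim x y) z ∘ g = Sum.elim z x :=
      fun x y z => by ext (i | i) <;> rfl
    have hg' : ∀ (x : ι → M) (y : Fin n → M) z, Sum.elim (Sum.elim x y) z ∘ g' = Sum.elim z y :=
      fun x y z => by ext (i | i) <;> rfl
    -- The consistency clause matters: without it the implication could hold vacuously and the
    -- instances would not be k-inconsistent.
    let R' : Set (ι ⊕ Fin n → M) := {v | ∃ z, Sum.elim v z ∈ (fun u => u ∘ g) ⁻¹' R} ∩
      {v | ∀ z, Sum.elim v z ∈ ((fun u => u ∘ g) ⁻¹' R)ᶜ ∪ (fun u => u ∘ g') ⁻¹' {v | χ.Realize v}}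
    have hR' : A.Definable L R' := (definable_exists (hR.preimage_comp g)).inter (definable_forall
      ((hR.preimage_comp g).compl.union ((definable_setOf_realize (A := A) χ).preimage_comp g')))
    have hmem : ∀ (x : ι → M) (y : Fin n → M), Sum.elim x y ∈ R' ↔
        (∃ z, Sum.elim z x ∈ R) ∧ ∀ z, Sum.elim z x ∈ R → χ.Realize (Sum.elim z y) := by
      intro x y
      simp [R', hg, hg', imp_iff_not_or]
    refine h.not_mem_of_divides hR' hb hc (k := k) ?_ ((hmem a b).2
      ⟨⟨d, (hUR d).1 hdU⟩, fun z hz => (hχ z).1 (hUV z ((hUR z).2 hz))⟩)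
    rintro s hs ⟨x, hx⟩
    -- For k = 0 no instance supplies a point z, but then any tuple already contradicts the
    -- inconsistency of the empty family.
    rcases s.eq_empty_or_nonempty with rfl | ⟨i₀, hi₀⟩
    · exact hk ∅ hs ⟨d, by simp⟩
    · obtain ⟨z, hz⟩ := ((hmem _ _).1 (hx i₀ hi₀)).1
      exact hk s hs ⟨z, fun i hi => ((hmem _ _).1 (hx i hi)).2 z hz⟩
  obtain ⟨d', hd'⟩ := hM.exists_mem_iInter
    (hM.mk_union_lt (hM.mk_union_lt hA ha) (hM.mk_union_lt hB hA)) hι' F hdef hfip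
  refine ⟨d', sameType_iff.2 fun S hS => ⟨fun h => ?_, fun h => hd' (Sum.inl ⟨S, hS, h⟩)⟩,
    fun n φ b hb hφ hf => hd' (Sum.inr ⟨⟨n, φ, b⟩, hb, hf⟩) hφ⟩
  by_contra hb
  exact hd' (Sum.inl ⟨Sᶜ, hS.compl, hb⟩) h

end Independence

theorem hasLeftExtension {L : FirstOrder.Language.{u, v}} {T : L.Theory} {M : Type w}
    [L.Structure M] {κ : Cardinal.{w}} (hM : IsMonster L T M κ) {A : Set M} (hA : #A < κ)
    (hFD : ForkingEqDividing L A) : HasLeftExtension.{u, v, w, x, y} L κ A := by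
  intro ι ι' a d B hB hd had h
  -- Smallness concerns the entries of d, not its index type, so the extension is found for the
  -- enumeration of the range and then reindexed.
  obtain ⟨d', htp, hnf⟩ := h.exists_extension hM hA hB hFD
    ((Cardinal.mk_le_mk_of_subset had).trans_lt hd) hd (fun z : Set.range d => (z : M))
  exact ⟨d' ∘ Set.rangeFactorization d, htp.comp (Set.rangeFactorization d), hnf.comp _⟩

end ForkDiv

open ForkDiv

theorem mainTheorem8 (L : FirstOrder.Language.{u, v}) (T : L.Theory) (M : Type w) [L.Structure M]
    (κ : Cardinal.{w}) (hM : ForkDiv.IsMonster L T M κ) (A : Set M) (hA : #A < κ)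
    (hFD : ForkDiv.ForkingEqDividing L A) :
    -- extension base
    ForkDiv.IsExtensionBase.{u, v, w, x} L A ∧
    -- left extension
    ForkDiv.HasLeftExtension.{u, v, w, x, y} L κ A ∧
    -- non-degenerate
    (∀ (ι : Type x) (a : ι → M),
      ForkDiv.NonForking L a A (Set.range a) ↔ Set.range a ⊆ ForkDiv.acl L A) ∧
    -- rigid
    (∀ (ι : Type x) (ι' : Type y) (a : ι → M) (b : ι' → M),
      List.TFAE [
        ForkDiv.NonForking L a A (Set.range b),
        ForkDiv.NonForking L a (ForkDiv.acl L A) (Set.range b),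
        ForkDiv.NonForking L a A (ForkDiv.acl L (A ∪ Set.range b)),
        ForkDiv.NonForking L (fun z : ForkDiv.acl L (A ∪ Set.range a) => (z : M)) A (Set.range b),
        ForkDiv.NonForking L (fun z : ForkDiv.acl L (A ∪ Set.range a) => (z : M))
          (ForkDiv.acl L A) (ForkDiv.acl L (A ∪ Set.range b))]) := by
  have := hM.nonempty
  refine ⟨fun ι a => nonForking_of_subset_acl hFD (subset_acl A) a, hasLeftExtension hM hA hFD,
    fun ι a => ⟨fun h => h.subset_acl_of_self hM hA, fun h => nonForking_of_subset_acl hFD h a⟩,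
    fun ι ι' a b => ?_⟩
  have hb : Set.range b ⊆ acl L (A ∪ Set.range b) := Set.subset_union_right.trans (subset_acl _)
  have hA₂ : acl L A ⊆ acl L (A ∪ Set.range b) := acl_mono Set.subset_union_left
  have left : ∀ {C B : Set M},
      NonForking L (fun z : acl L (A ∪ Set.range a) => (z : M)) C B → NonForking L a C B :=
    fun h => h.comp fun i => ⟨a i, subset_acl _ (Or.inr ⟨i, rfl⟩)⟩
  tfae_have 1 → 3 := fun h => h.acl_right hFD
  tfae_have 3 → 2 := fun h => (nonForking_acl_iff hM hA).2
    (h.mono (Set.union_subset (Set.union_subset (hb.trans Set.subset_union_left)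
      (hA₂.trans Set.subset_union_left)) Set.subset_union_right))
  tfae_have 2 → 1 := fun h => ((nonForking_acl_iff hM hA).1 h).mono
    (Set.union_subset_union_left _ Set.subset_union_left)
  tfae_have 1 → 4 := fun h => h.acl_left hFD
  tfae_have 4 → 5 := fun h => (nonForking_acl_iff hM hA).2
    ((h.acl_right hFD).mono (Set.union_subset_union_left _ (Set.union_subset subset_rfl hA₂)))
  tfae_have 5 → 2 := fun h => left (h.mono (Set.union_subset_union_left _ hb))
  tfae_finish
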